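/- Consider the planar system $\dot x=y,\ \dot y=-g(x)$, where $g$ is a real function on some interval $]-\delta,\delta[$, $\delta>0$, with $g(0)=0$. The origin is a *center* if all orbits, other than the origin, meeting some neighborhood of it are closed and surround it; the center is *isochronous* if the (minimal) periods of all these orbits in some neighborhood of the origin are equal. Let $G(x)=\int_0^x g(u)\,du$. If $g'(0)=\lambda^2$ with $\lambda>0$, let $X$ be the continuous function near $0$ with $X(x)^2=2G(x)$ and $xX(x)>0$ for $x\neq 0$; a function $h$, continuous and odd in a neighborhood of $0$, is called the *Urabe function* of the system if $$g(x)=\lambda\,\frac{X(x)}{1+h(X(x))}\qquad\text{for all } x \text{ near } 0 .$$ Let $h$ be an odd function of class $C^k$, $1\le k\le\infty$ (resp. real-analytic) on a neighborhood of $0\in\mathbb R$ and let $\lambda>0$. Then there is a function $g$ of class $C^{k-1}$ and of class $C^1$ (resp. real-analytic) on some neighborhood of $0\in\mathbb R$ with $g(0)=0$ and $g'(0)=\lambda^2$ such that the origin is an isochronous center of the system $\dot x=y,\ \dot y=-g(x)$ and $h$ is its Urabe function. Moreover $g$ is unique: any two functions of class $C^{k-1}$ (resp. real-analytic) on neighborhoods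 of $0$ with these properties (for $k=1$: continuous functions, differentiable at $0$) coincide near $0$. -/

import Mathlib

open Set Topology

noncomputable section

/-- `γ : ℝ → ℝ²` is a solution, for all times, of the planar system `x' = y`, `y' = -g x`, where
`g` is considered as a function on `J` only. -/
def IsPlanarSolution (J : Set ℝ) (g : ℝ → ℝ) (γ : ℝ → ℝ × ℝ) : Prop :=
  ∀ t, (γ t).1 ∈ J ∧ HasDerivAt γ ((γ t).2, -g (γ t).1) t

/-- `T` is the (minimal positive) period of `γ`. In particular `γ` is not constant. -/
def HasMinimalPeriod (γ : ℝ → ℝ × ℝ) (T : ℝ) : Prop :=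
  IsLeast {S : ℝ | 0 < S ∧ Function.Periodic γ S} T

/-- The trace of `γ` surrounds the origin: the origin is not on it and lies in a bounded
connected component of its complement. -/
def SurroundsOrigin (γ : ℝ → ℝ × ℝ) : Prop :=
  (0 : ℝ × ℝ) ∉ range γ ∧ Bornology.IsBounded (connectedComponentIn (range γ)ᶜ (0 : ℝ × ℝ))

/-- The origin is a center of `x' = y`, `y' = -g x`: it is a singular point, and the orbits of
all other points of some neighborhood are closed and surround it. -/
def IsCenter (J : Set ℝ) (g : ℝ → ℝ) : Prop :=
  g 0 = 0 ∧ ∃ U ∈ 𝓝 (0 : ℝ × ℝ), ∀ p ∈ U, p ≠ 0 →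
    ∃ γ, IsPlanarSolution J g γ ∧ γ 0 = p ∧ (∃ T, HasMinimalPeriod γ T) ∧ SurroundsOrigin γ

/-- The origin is an isochronous center: a center such that all orbits (other than the origin)
meeting some neighborhood of it have the same period. -/
def IsIsochronousCenter (J : Set ℝ) (g : ℝ → ℝ) : Prop :=
  IsCenter J g ∧ ∃ T : ℝ, ∃ U ∈ 𝓝 (0 : ℝ × ℝ), ∀ p ∈ U, p ≠ 0 →
    ∀ γ, IsPlanarSolution J g γ → γ 0 = p → HasMinimalPeriod γ T

/-- The potential `G x = ∫₀ˣ g`. -/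
def potential (g : ℝ → ℝ) (x : ℝ) : ℝ := ∫ u in (0 : ℝ)..x, g u

/-- `h` is the Urabe function of `x' = y`, `y' = -g x`, where `g' 0 = lam ^ 2`, `lam > 0`:
`h` is continuous and odd near `0`, and near `0` one has `g x = lam * X x / (1 + h (X x))`, where
`X` is the continuous function with `X ^ 2 = 2 G` and `x * X x > 0` for `x ≠ 0`. -/
def IsUrabeFunction (lam : ℝ) (g h : ℝ → ℝ) : Prop :=
  ∃ η > 0, ContinuousOn h (Ioo (-η) η) ∧ (∀ s ∈ Ioo (-η) η, h (-s) = -h s) ∧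
    ∃ ρ > 0, ∃ X : ℝ → ℝ, ContinuousOn X (Ioo (-ρ) ρ) ∧
      ∀ x ∈ Ioo (-ρ) ρ,
        X x ^ 2 = 2 * potential g x ∧ (x ≠ 0 → 0 < x * X x) ∧
        X x ∈ Ioo (-η) η ∧ 1 + h (X x) ≠ 0 ∧ g x = lam * X x / (1 + h (X x))

/-- `g`, considered on `]-δ, δ[`, satisfies `g 0 = 0`, `g' 0 = lam ^ 2`, the origin is an
isochronous center of `x' = y`, `y' = -g x`, and `h` is the Urabe function of this system. -/
structure IsIsochronousWithUrabe (lam : ℝ) (h : ℝ → ℝ) (δ : ℝ) (g : ℝ → ℝ) : Prop where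
  pos : 0 < δ
  map_zero : g 0 = 0
  hasDerivAt_zero : HasDerivAt g (lam ^ 2) 0
  isochronous : IsIsochronousCenter (Ioo (-δ) δ) g
  urabe : IsUrabeFunction lam g h

end

/-! Differentiating `X ^ 2 = 2 G` and inserting the Urabe equation gives `dx/dX = (1 + h X) / lam`.
So `x = e X` with `e s = (s + ∫₀ˢ h) / lam`, and `g` must be `lam * X / (1 + h X)` with `X = e⁻¹`:
this is uniqueness (`IsUrabeFunction.eventuallyEq`), and it dictates the construction. For this `g`,
put `X = r sin φ`, `y = r cos φ`. The radius is constant and `φ' = lam / (1 + h (r sin φ))`. A full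
turn takes time `(1 / lam) ∫ (1 + h (r sin φ)) dφ = 2π / lam`, since `h` is odd
(`exists_angle_function`, `exists_periodic_orbit`). To make `e` a bijection of `ℝ`, `h` is replaced
by a global odd `k`, equal to `h` near `0`, with `|k| ≤ 1 / 2`. Smoothness of `g` comes from the
inverse function theorem. -/

theorem AnalyticAt.of_eventually_hasDerivAt {f F : ℝ → ℝ} {a : ℝ} (hf : AnalyticAt ℝ f a)
    (hF : ∀ᶠ x in 𝓝 a, HasDerivAt F (f x) x) : AnalyticAt ℝ F a := by
  obtain ⟨p, r, hp⟩ := hf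
  obtain ⟨R₁, hR₁, hball⟩ := Metric.eventually_nhds_iff.1 hF
  obtain ⟨R₂, hR₂, hR₂r⟩ := ENNReal.lt_iff_exists_nnreal_btwn.1 hp.r_pos
  have hR₂' : 0 < R₂ := by exact_mod_cast hR₂
  have hsum := p.summable_norm_mul_pow (hR₂r.trans_le hp.r_le)
  -- Coefficients of the termwise integrated series, with constant term `F a`.
  let c : ℕ → ℝ := fun n => Nat.casesOn n (F a) fun m => p.coeff m / (m + 1)
  refine ⟨FormalMultilinearSeries.ofScalars ℝ c, hasFPowerSeriesAt_iff.2 ?_⟩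
  have hz0 : ∀ᶠ z : ℝ in 𝓝 0, |z| < min R₁ R₂ := by
    have := Metric.ball_mem_nhds (0 : ℝ) (lt_min hR₁ (NNReal.coe_pos.2 hR₂'))
    filter_upwards [this] with z hz
    simpa using hz
  filter_upwards [hz0] with z hz
  have habs : ∀ s ∈ uIcc 0 z, |s| ≤ |z| := fun s hs => by
    rcases le_total 0 z with h0 | h0
    · rw [uIcc_of_le h0] at hs
      rw [abs_of_nonneg hs.1, abs_of_nonneg h0]; exact hs.2
    · rw [uIcc_of_ge h0] at hs
      rw [abs_of_nonpos hs.2, abs_of_nonpos h0]; linarith [hs.1]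
  have hser : ∀ s ∈ uIcc 0 z, HasSum (fun n => s ^ n * p.coeff n) (f (a + s)) := fun s hs => by
    have hs' : s ∈ Metric.eball (0 : ℝ) r := by
      have h1 : |s| < R₂ := ((habs s hs).trans_lt hz).trans_le (min_le_right _ _)
      refine Metric.eball_subset_eball hR₂r.le ?_
      rw [Metric.eball_coe]
      simpa using h1
    simpa [FormalMultilinearSeries.apply_eq_pow_smul_coeff] using hp.hasSum hs'
  have hint : HasSum (fun n => ∫ s in (0 : ℝ)..z, s ^ n * p.coeff n)
      (∫ s in (0 : ℝ)..z, f (a + s)) := by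
    refine intervalIntegral.hasSum_integral_of_dominated_convergence
      (fun n _ => ‖p n‖ * (R₂ : ℝ) ^ n) (fun n => ?_) (fun n => ?_) ?_ ?_ ?_
    · exact (by fun_prop : Continuous fun s : ℝ => s ^ n * p.coeff n).aestronglyMeasurable
    · refine .of_forall fun s hs => ?_
      rw [FormalMultilinearSeries.norm_apply_eq_norm_coef, norm_mul, mul_comm, norm_pow]
      gcongr
      exact ((habs s (uIoc_subset_uIcc hs)).trans_lt hz).le.trans (min_le_right _ _)
    · exact .of_forall fun _ _ => hsum
    · exact intervalIntegrable_const
    · exact .of_forall fun s hs => hser s (uIoc_subset_uIcc hs)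
  have hder : ∀ s ∈ uIcc 0 z, HasDerivAt (fun s => F (a + s)) (f (a + s)) s := fun s hs => by
    have : HasDerivAt F (f (a + s)) (a + s) := hball (by
      simpa [Real.dist_eq] using ((habs s hs).trans_lt hz).trans_le (min_le_left _ _))
    simpa using this.comp_const_add a s
  have hcont : ContinuousOn (fun s => f (a + s)) (uIcc 0 z) := by
    refine hp.continuousOn.comp (by fun_prop) fun s hs => ?_
    refine Metric.eball_subset_eball hR₂r.le ?_
    rw [Metric.eball_coe]
    simpa [Real.dist_eq] using ((habs s hs).trans_lt hz).trans_le (min_le_right _ _)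
  rw [intervalIntegral.integral_eq_sub_of_hasDerivAt hder hcont.intervalIntegrable] at hint
  rw [← hasSum_nat_add_iff' 1]
  simp only [FormalMultilinearSeries.coeff_ofScalars, Finset.range_one, Finset.sum_singleton]
  have hterm : (fun n => z ^ (n + 1) • c (n + 1)) =
      fun n => ∫ s in (0 : ℝ)..z, s ^ n * p.coeff n := by
    funext n
    simp only [c, smul_eq_mul, intervalIntegral.integral_mul_const, integral_pow]
    simp
    ring
  have hval : F (a + z) - z ^ 0 • c 0 = F (a + z) - F (a + 0) := by simp [c]
  rw [hterm, hval]
  exact hint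

/-! ### Change of variable and change of time -/

/-- For continuous `k` with `|k| ≤ 1 / 2`, the map `s ↦ (s + ∫₀ˢ k) / lam` is an increasing
bijection of `ℝ`. -/
theorem exists_orderIso_of_abs_le_half {lam : ℝ} (hlam : 0 < lam) {k : ℝ → ℝ} (hk : Continuous k)
    (hb : ∀ s, |k s| ≤ 1 / 2) :
    ∃ e : ℝ ≃o ℝ, (∀ s, e s = (s + ∫ u in (0 : ℝ)..s, k u) / lam) ∧
      (∀ s, HasDerivAt e ((1 + k s) / lam) s) ∧
      (∀ x, HasDerivAt e.symm (lam / (1 + k (e.symm x))) x) ∧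
      ∀ s, |e s| ≤ 3 / 2 * |s| / lam := by
  let F : ℝ → ℝ := fun s => (s + ∫ u in (0 : ℝ)..s, k u) / lam
  have hpos : ∀ s, 0 < 1 + k s := fun s => by linarith [(abs_le.1 (hb s)).1]
  have hF : ∀ s, HasDerivAt F ((1 + k s) / lam) s := fun s =>
    ((hasDerivAt_id s).add (hk.integral_hasStrictDerivAt 0 s).hasDerivAt).div_const lam
  have hmono : StrictMono F := strictMono_of_hasDerivAt_pos hF fun s => div_pos (hpos s) hlam
  -- Hence `F s` lies between `s / (2 lam)` and `3 s / (2 lam)`, which gives both surjectivity and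
  -- the final bound.
  have hI : ∀ s, |∫ u in (0 : ℝ)..s, k u| ≤ 1 / 2 * |s| := fun s => by
    simpa using intervalIntegral.norm_integral_le_of_norm_le_const (a := 0) (b := s) (f := k)
      (C := 1 / 2) (fun x _ => hb x)
  have hcont : Continuous F := continuous_iff_continuousAt.2 fun s => (hF s).continuousAt
  have hsurj : Function.Surjective F := by
    refine hcont.surjective ?_ ?_
    · refine Filter.tendsto_atTop_mono' _ (f₁ := fun s => s / 2 / lam) ?_ ?_
      · filter_upwards [Filter.eventually_ge_atTop 0] with s hs
        have := abs_le.1 (hI s)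
        rw [abs_of_nonneg hs] at this
        refine div_le_div_of_nonneg_right ?_ hlam.le
        linarith [this.1]
      · exact (Filter.tendsto_id.atTop_div_const two_pos).atTop_div_const hlam
    · refine Filter.tendsto_atBot_mono' _ (f₁ := fun s => s / 2 / lam) ?_ ?_
      · filter_upwards [Filter.eventually_le_atBot 0] with s hs
        have := abs_le.1 (hI s)
        rw [abs_of_nonpos hs] at this
        refine div_le_div_of_nonneg_right ?_ hlam.le
        linarith [this.2]
      · exact (Filter.tendsto_id.atBot_div_const two_pos).atBot_div_const hlam
  let e := hmono.orderIsoOfSurjective F hsurj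
  have he : (e : ℝ → ℝ) = F := rfl
  refine ⟨e, fun s => rfl, hF, fun x => ?_, fun s => ?_⟩
  · rw [← inv_div]
    exact HasDerivAt.of_local_left_inverse e.symm.continuous.continuousAt (hF (e.symm x))
      (div_pos (hpos _) hlam).ne' (.of_forall e.apply_symm_apply)
  · rw [he]
    simp only [F, abs_div, abs_of_pos hlam]
    gcongr
    linarith [abs_add_le s (∫ u in (0 : ℝ)..s, k u), hI s]

/-- Time change: for odd `k`, `θ ↦ (θ + ∫₀^θ k (r sin φ) dφ) / lam` is inverse to a
function `φ` with `φ' = lam / (1 + k (r sin φ))` advancing by `2π` in time `2π / lam`. -/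
theorem exists_angle_function {lam : ℝ} (hlam : 0 < lam) {k : ℝ → ℝ} (hk : Continuous k)
    (hb : ∀ s, |k s| ≤ 1 / 2) (hodd : ∀ s, k (-s) = -k s) (r : ℝ) :
    ∃ φ : ℝ ≃o ℝ, (∀ t, HasDerivAt φ (lam / (1 + k (r * Real.sin (φ t)))) t) ∧
      ∀ t, φ (t + 2 * Real.pi / lam) = φ t + 2 * Real.pi := by
  have hk' : Continuous fun θ => k (r * Real.sin θ) := by fun_prop
  obtain ⟨e, he, -, hes, -⟩ := exists_orderIso_of_abs_le_half hlam hk' fun s => hb _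
  have hper : Function.Periodic (fun θ => k (r * Real.sin θ)) (2 * Real.pi) := fun θ => by simp
  have hzero : ∫ θ in (-Real.pi)..Real.pi, k (r * Real.sin θ) = 0 := by
    have := intervalIntegral.integral_comp_neg (fun θ => k (r * Real.sin θ))
      (a := -Real.pi) (b := Real.pi)
    simp only [Real.sin_neg, mul_neg, hodd, intervalIntegral.integral_neg, neg_neg] at this
    linarith
  have hshift : ∀ θ, e (θ + 2 * Real.pi) = e θ + 2 * Real.pi / lam := fun θ => by
    have h1 := hper.intervalIntegral_add_eq θ (-Real.pi)
    rw [show -Real.pi + 2 * Real.pi = Real.pi by ring, hzero] at h1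
    have h2 := intervalIntegral.integral_add_adjacent_intervals
      (hk'.intervalIntegrable (μ := MeasureTheory.volume) 0 θ)
      (hk'.intervalIntegrable θ (θ + 2 * Real.pi))
    rw [he, he, ← h2, h1]
    ring
  refine ⟨e.symm, hes, fun t => ?_⟩
  rw [OrderIso.symm_apply_eq, hshift, e.apply_symm_apply]

theorem exists_polar_angle {a b r : ℝ} (hr : 0 ≤ r) (h : a ^ 2 + b ^ 2 = r ^ 2) :
    ∃ θ : ℝ, a = r * Real.sin θ ∧ b = r * Real.cos θ := by
  have hn : ‖(⟨b, a⟩ : ℂ)‖ = r := by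
    rw [Complex.norm_def, Complex.normSq_apply, ← Real.sqrt_sq hr, ← h]
    congr 1
    ring
  exact ⟨Complex.arg ⟨b, a⟩, by simpa [hn] using (Complex.norm_mul_sin_arg ⟨b, a⟩).symm,
    by simpa [hn] using (Complex.norm_mul_cos_arg ⟨b, a⟩).symm⟩

/-! ### Closed orbits and the isochronous center -/

/-- A curve whose trace is a whole bounded level set `{E = c}` of a continuous function `E` with
`E 0 < c`, such that `{E < c}` is bounded, surrounds the origin. -/
theorem surroundsOrigin_of_level {γ : ℝ → ℝ × ℝ} {E : ℝ × ℝ → ℝ} {c : ℝ} (hE : Continuous E)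
    (h0 : E 0 < c) (hγ : range γ = {p | E p = c}) (hbdd : Bornology.IsBounded {p | E p < c}) :
    SurroundsOrigin γ := by
  have h0' : (0 : ℝ × ℝ) ∉ range γ := by
    rw [hγ]; exact h0.ne
  refine ⟨h0', hbdd.subset fun p hp => ?_⟩
  by_contra hlt
  obtain ⟨q, hq, hqc⟩ := isPreconnected_connectedComponentIn.intermediate_value
    (mem_connectedComponentIn h0') hp hE.continuousOn ⟨h0.le, not_lt.1 hlt⟩
  exact connectedComponentIn_subset _ _ hq (hγ ▸ hqc)

/-- The closed orbits of the system given by `g (e s) = lam * s / (1 + k s)`, where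
`e' = (1 + k) / lam` with `k` odd. -/
theorem exists_periodic_orbit {lam : ℝ} (hlam : 0 < lam) {k : ℝ → ℝ} (hk : Continuous k)
    (hb : ∀ s, |k s| ≤ 1 / 2) (hodd : ∀ s, k (-s) = -k s) {e : ℝ ≃o ℝ} (he0 : e 0 = 0)
    (he : ∀ s, HasDerivAt e ((1 + k s) / lam) s) (heb : ∀ s, |e s| ≤ 3 / 2 * |s| / lam)
    {r : ℝ} (hr : 0 < r) {p : ℝ × ℝ} (hp : e.symm p.1 ^ 2 + p.2 ^ 2 = r ^ 2) :
    ∃ γ : ℝ → ℝ × ℝ,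
      (∀ t, HasDerivAt γ ((γ t).2,
        -(lam * e.symm (γ t).1 / (1 + k (e.symm (γ t).1)))) t) ∧
      γ 0 = p ∧ HasMinimalPeriod γ (2 * Real.pi / lam) ∧ SurroundsOrigin γ ∧
      ∀ t, |(γ t).1| ≤ 3 / 2 * r / lam := by
  obtain ⟨φ, hφ, hφT⟩ := exists_angle_function hlam hk hb hodd r
  obtain ⟨θ₀, hθ₁, hθ₂⟩ := exists_polar_angle hr.le hp
  have hpos : ∀ s, 0 < 1 + k s := fun s => by linarith [(abs_le.1 (hb s)).1]
  let t₀ := φ.symm θ₀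
  let γ : ℝ → ℝ × ℝ := fun t =>
    (e (r * Real.sin (φ (t + t₀))), r * Real.cos (φ (t + t₀)))
  have hinv : ∀ t, e.symm (γ t).1 = r * Real.sin (φ (t + t₀)) := fun t => e.symm_apply_apply _
  have hT : 0 < 2 * Real.pi / lam := div_pos Real.two_pi_pos hlam
  refine ⟨γ, fun t => ?_, ?_, ⟨⟨hT, fun t => ?_⟩, fun S hS => ?_⟩, ?_, fun t => ?_⟩
  · have hφ' := (hφ (t + t₀)).comp_add_const t t₀
    have h1 := (he _).comp t (hφ'.sin.const_mul r)
    have h2 := hφ'.cos.const_mul r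
    rw [hinv]
    refine HasDerivAt.prodMk (h1.congr_deriv ?_) (h2.congr_deriv ?_)
    · have := (hpos (r * Real.sin (φ (t + t₀)))).ne'
      simp only [γ]
      field_simp
    · have := (hpos (r * Real.sin (φ (t + t₀)))).ne'
      field_simp
  · have : φ (0 + t₀) = θ₀ := by simp [t₀]
    simp only [γ, this, ← hθ₁, ← hθ₂, e.apply_symm_apply]
  · have : φ (t + 2 * Real.pi / lam + t₀) = φ (t + t₀) + 2 * Real.pi := by
      rw [← hφT]; congr 1; ring
    simp only [γ, this, Real.sin_add_two_pi, Real.cos_add_two_pi]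
  -- In a time `S < 2π / lam` the angle advances by strictly between `0` and `2π`, so sine and
  -- cosine cannot both return.
  · by_contra hlt
    rw [not_le] at hlt
    have h1 : γ S = γ 0 := by simpa using hS.2 0
    have hs : Real.sin (φ (S + t₀)) = Real.sin (φ (0 + t₀)) := by
      have := congrArg (fun q => e.symm q.1) h1
      simp only [hinv] at this
      exact mul_left_cancel₀ hr.ne' this
    have hc : Real.cos (φ (S + t₀)) = Real.cos (φ (0 + t₀)) :=
      mul_left_cancel₀ hr.ne' (congrArg Prod.snd h1)
    have h2 : φ (0 + t₀) < φ (S + t₀) := φ.strictMono (by linarith [hS.1])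
    have h3 : φ (S + t₀) < φ (0 + t₀) + 2 * Real.pi := by
      rw [← hφT]; exact φ.strictMono (by linarith)
    have h4 : Real.cos (φ (S + t₀) - φ (0 + t₀)) = 1 := by
      rw [Real.cos_sub, hs, hc]
      linarith [Real.sin_sq_add_cos_sq (φ (0 + t₀))]
    rw [Real.cos_eq_one_iff_of_lt_of_lt (by linarith) (by linarith)] at h4
    linarith
  · refine surroundsOrigin_of_level (E := fun q => e.symm q.1 ^ 2 + q.2 ^ 2) (c := r ^ 2)
      ?_ ?_ ?_ ?_
    · have := e.symm.continuous
      fun_prop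
    · have : e.symm 0 = 0 := by rw [OrderIso.symm_apply_eq, he0]
      simpa [this] using pow_pos hr 2
    · ext q
      constructor
      · rintro ⟨t, rfl⟩
        simp only [mem_ofPred_eq, hinv]
        simp only [γ]
        linear_combination r ^ 2 * Real.sin_sq_add_cos_sq (φ (t + t₀))
      · intro hq
        obtain ⟨θ, h1, h2⟩ := exists_polar_angle hr.le hq
        refine ⟨φ.symm θ - t₀, ?_⟩
        simp only [γ, sub_add_cancel, φ.apply_symm_apply, ← h1, ← h2, e.apply_symm_apply]
    · refine ((Metric.isBounded_Icc (e (-r)) (e r)).prod (Metric.isBounded_Icc (-r) r)).subset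
        fun q hq => ?_
      have hq' : e.symm q.1 ^ 2 + q.2 ^ 2 < r ^ 2 := hq
      have h1 := abs_le.1 (abs_le_of_sq_le_sq (by nlinarith [sq_nonneg q.2]) hr.le :
        |e.symm q.1| ≤ r)
      have h2 := abs_le.1 (abs_le_of_sq_le_sq (by nlinarith [sq_nonneg (e.symm q.1)]) hr.le :
        |q.2| ≤ r)
      exact ⟨⟨e.le_symm_apply.1 h1.1, e.symm_apply_le.1 h1.2⟩, h2⟩
  · refine (heb _).trans ?_
    gcongr
    rw [abs_mul, abs_of_pos hr]
    exact mul_le_of_le_one_right hr.le (Real.abs_sin_le_one _)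

/-- Isochronicity concerns every solution through a point; this identifies each with the explicit
one. -/
theorem IsPlanarSolution.eq_of_lipschitzOnWith {J : Set ℝ} {g : ℝ → ℝ} {K : NNReal}
    (hg : LipschitzOnWith K g J) {γ₁ γ₂ : ℝ → ℝ × ℝ} (h₁ : IsPlanarSolution J g γ₁)
    (h₂ : IsPlanarSolution J g γ₂) (h : γ₁ 0 = γ₂ 0) : γ₁ = γ₂ := by
  refine ODE_solution_unique_univ (v := fun _ p => (p.2, -g p.1)) (s := fun _ => J ×ˢ univ)
    (K := max 1 K) (t₀ := 0) (fun _ => ?_) (fun t => ⟨(h₁ t).2, (h₁ t).1, mem_univ _⟩)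
    (fun t => ⟨(h₂ t).2, (h₂ t).1, mem_univ _⟩) h
  have hfst : LipschitzOnWith K (fun p : ℝ × ℝ => -g p.1) (J ×ˢ univ) := by
    have := hg.comp (LipschitzWith.prod_fst.lipschitzOnWith (s := J ×ˢ (univ : Set ℝ)))
      fun p hp => hp.1
    rw [mul_one] at this
    exact this.neg
  exact (LipschitzWith.prod_snd.lipschitzOnWith).prodMk hfst

theorem isIsochronousCenter_of_orderIso {lam : ℝ} (hlam : 0 < lam) {k : ℝ → ℝ}
    (hk : Continuous k) (hb : ∀ s, |k s| ≤ 1 / 2) (hodd : ∀ s, k (-s) = -k s) {e : ℝ ≃o ℝ}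
    (he0 : e 0 = 0) (he : ∀ s, HasDerivAt e ((1 + k s) / lam) s)
    (heb : ∀ s, |e s| ≤ 3 / 2 * |s| / lam) {δ : ℝ} (hδ : 0 < δ) {K : NNReal}
    (hK : LipschitzOnWith K (fun x => lam * e.symm x / (1 + k (e.symm x))) (Ioo (-δ) δ)) :
    IsIsochronousCenter (Ioo (-δ) δ) fun x => lam * e.symm x / (1 + k (e.symm x)) := by
  have hs0 : e.symm 0 = 0 := by rw [OrderIso.symm_apply_eq, he0]
  -- Radius `r < δ * lam / 2` keeps orbits in the strip, as `|x| ≤ 3 r / (2 lam) < 3 δ / 4`.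
  let U : Set (ℝ × ℝ) := {p | e.symm p.1 ^ 2 + p.2 ^ 2 < (δ * lam / 2) ^ 2}
  have hU : U ∈ 𝓝 (0 : ℝ × ℝ) := by
    have hc : Continuous fun p : ℝ × ℝ => e.symm p.1 ^ 2 + p.2 ^ 2 := by
      have := e.symm.continuous
      fun_prop
    refine (isOpen_lt hc continuous_const).mem_nhds ?_
    have : 0 < δ * lam / 2 := by positivity
    simpa [hs0] using pow_pos this 2
  have key : ∀ p ∈ U, p ≠ 0 → ∃ γ, IsPlanarSolution (Ioo (-δ) δ)
      (fun x => lam * e.symm x / (1 + k (e.symm x))) γ ∧ γ 0 = p ∧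
      HasMinimalPeriod γ (2 * Real.pi / lam) ∧ SurroundsOrigin γ := by
    intro p hp hp0
    have hE : 0 < e.symm p.1 ^ 2 + p.2 ^ 2 := by
      by_contra hle
      have h1 : e.symm p.1 = 0 := by nlinarith [sq_nonneg (e.symm p.1), sq_nonneg p.2]
      have h2 : p.2 = 0 := by nlinarith [sq_nonneg (e.symm p.1), sq_nonneg p.2]
      rw [OrderIso.symm_apply_eq, he0] at h1
      exact hp0 (Prod.ext h1 h2)
    have hr := Real.sqrt_pos.2 hE
    have hrδ : Real.sqrt (e.symm p.1 ^ 2 + p.2 ^ 2) < δ * lam / 2 :=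
      (Real.sqrt_lt' (by positivity)).2 hp
    obtain ⟨γ, h1, h2, h3, h4, h5⟩ :=
      exists_periodic_orbit hlam hk hb hodd he0 he heb hr (Real.sq_sqrt hE.le).symm
    refine ⟨γ, fun t => ⟨abs_lt.1 ((h5 t).trans_lt ?_), h1 t⟩, h2, h3, h4⟩
    rw [div_lt_iff₀ hlam]
    nlinarith [mul_pos hδ hlam]
  refine ⟨⟨by simp [hs0], U, hU, fun p hp hp0 => ?_⟩, 2 * Real.pi / lam, U, hU,
    fun p hp hp0 γ hγ hγ0 => ?_⟩
  · obtain ⟨γ, h1, h2, h3, h4⟩ := key p hp hp0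
    exact ⟨γ, h1, h2, ⟨_, h3⟩, h4⟩
  · obtain ⟨γ', h1, h2, h3, -⟩ := key p hp hp0
    rwa [hγ.eq_of_lipschitzOnWith hK h1 (hγ0.trans h2.symm)]

/-! ### Regularity, truncation and uniqueness -/

theorem contDiffOn_of_hasDerivAt {n : WithTop ℕ∞} {f F : ℝ → ℝ} {s : Set ℝ} (hs : IsOpen s)
    (hF : ∀ x ∈ s, HasDerivAt F (f x) x) (hf : ContDiffOn ℝ n f s) : ContDiffOn ℝ n F s := by
  refine ((contDiffOn_succ_iff_deriv_of_isOpen hs).2 ⟨fun x hx =>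
    (hF x hx).differentiableAt.differentiableWithinAt, fun hn x hx => ?_,
    hf.congr fun x hx => (hF x hx).deriv⟩).of_le (le_self_add)
  -- The case `n = ω`: the criterion also asks that `F` be analytic.
  subst hn
  refine (AnalyticAt.of_eventually_hasDerivAt (f := f) ?_ ?_).analyticWithinAt
  · exact ((hf x hx).contDiffAt (hs.mem_nhds hx)).analyticAt
  · exact Filter.eventually_of_mem (hs.mem_nhds hx) hF

/-- The slope of `f` is that of `f ^ 2` divided by `f y + f x`. It is needed because `X` is only
assumed continuous. -/
theorem hasDerivAt_of_sq {f : ℝ → ℝ} {d x : ℝ} (hf : ContinuousAt f x) (h0 : f x ≠ 0)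
    (h : HasDerivAt (fun y => f y ^ 2) d x) : HasDerivAt f (d / (2 * f x)) x := by
  rw [hasDerivAt_iff_tendsto_slope] at h ⊢
  have hsum : ContinuousAt (fun y => f y + f x) x := hf.add continuousAt_const
  have hx : f x + f x ≠ 0 := by simpa [← two_mul] using h0
  rw [two_mul]
  refine (h.div (hsum.tendsto.mono_left nhdsWithin_le_nhds) hx).congr' ?_
  filter_upwards [nhdsWithin_le_nhds (hsum.eventually_ne hx)] with y hy
  simp only [Pi.div_apply, slope_def_field]
  rw [div_div, mul_comm, ← div_div]
  congr 1
  field_simp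
  ring

/-- Oddness gives `h 0 = 0`, so `|h| < 1 / 2` near `0`; clamping the argument to `[-c, c]` preserves
oddness and continuity. -/
theorem exists_truncation {h : ℝ → ℝ} {ε : ℝ} (hε : 0 < ε)
    (hodd : ∀ s ∈ Ioo (-ε) ε, h (-s) = -h s) (hh : ContinuousOn h (Ioo (-ε) ε)) :
    ∃ c > 0, c < ε ∧ ∃ k : ℝ → ℝ, Continuous k ∧ (∀ s, |k s| ≤ 1 / 2) ∧
      (∀ s, k (-s) = -k s) ∧ EqOn k h (Icc (-c) c) := by
  have h0 : h 0 = 0 := by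
    have := hodd 0 ⟨by linarith, hε⟩
    rw [neg_zero] at this
    linarith
  have hc0 : ContinuousAt h 0 := hh.continuousAt (Ioo_mem_nhds (by linarith) hε)
  obtain ⟨d, hd, hball⟩ := Metric.continuousAt_iff.1 hc0 (1 / 2) (by norm_num)
  let c := min d ε / 2
  have hc : 0 < c := half_pos (lt_min hd hε)
  have hcd : c < d := (half_lt_self (lt_min hd hε)).trans_le (min_le_left _ _)
  have hcε : c < ε := (half_lt_self (lt_min hd hε)).trans_le (min_le_right _ _)
  have hmem : ∀ s, max (-c) (min c s) ∈ Icc (-c) c := fun s =>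
    ⟨le_max_left _ _, max_le (by linarith) (min_le_left _ _)⟩
  have hsub : Icc (-c) c ⊆ Ioo (-ε) ε := Icc_subset_Ioo (by linarith) hcε
  refine ⟨c, hc, hcε, fun s => h (max (-c) (min c s)), ?_, fun s => ?_, fun s => ?_, ?_⟩
  · exact hh.comp_continuous (by fun_prop) fun s => hsub (hmem s)
  · have h1 : dist (max (-c) (min c s)) 0 < d := by
      rw [Real.dist_0_eq_abs]
      exact (abs_le.2 (hmem s)).trans_lt hcd
    have := hball h1
    rw [h0, Real.dist_0_eq_abs] at this
    exact this.le
  · have hneg : max (-c) (min c (-s)) = -max (-c) (min c s) := by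
      rw [← min_neg_neg, ← max_neg_neg, neg_neg, max_min_distrib_left,
        max_eq_right (by linarith : -c ≤ c)]
    rw [← hodd _ (hsub (hmem s)), ← hneg]
  · intro s hs
    simp only [min_eq_right hs.2, max_eq_right hs.1]

/-- Inverting `X ↦ (X + ∫₀ˣ h) / lam`: the only continuous solution near `0` of the equation
defining the Urabe function is the inverse function. -/
theorem IsUrabeFunction.eventuallyEq {lam : ℝ} (hlam : 0 < lam) {h g k : ℝ → ℝ}
    (hU : IsUrabeFunction lam g h) {δ : ℝ} (hδ : 0 < δ) (hg : ContinuousOn g (Ioo (-δ) δ))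
    {c : ℝ} (hc : 0 < c) (hkh : EqOn k h (Icc (-c) c)) {e : ℝ ≃o ℝ} (he0 : e 0 = 0)
    (he : ∀ s, HasDerivAt e ((1 + k s) / lam) s) :
    g =ᶠ[𝓝 0] fun x => lam * e.symm x / (1 + k (e.symm x)) := by
  obtain ⟨η, hη, -, -, ρ, hρ, X, hX, hall⟩ := hU
  have hX0 : X 0 = 0 := by
    have := (hall 0 ⟨by linarith, hρ⟩).1
    simpa [potential] using this
  have hXc : ContinuousAt X 0 := hX.continuousAt (Ioo_mem_nhds (by linarith) hρ)
  have hev : ∀ᶠ x in 𝓝 0, X x ∈ Ioo (-c) c :=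
    hXc.eventually (by rw [hX0]; exact Ioo_mem_nhds (by linarith) hc)
  obtain ⟨d, hd, hball⟩ := Metric.eventually_nhds_iff.1 hev
  let R := min d (min ρ δ)
  have hR : 0 < R := lt_min hd (lt_min hρ hδ)
  have hRd : ∀ x ∈ Ioo (-R) R, X x ∈ Ioo (-c) c := fun x hx => hball (by
    rw [Real.dist_0_eq_abs]
    exact (abs_lt.2 hx).trans_le (min_le_left _ _))
  have hRρ : Ioo (-R) R ⊆ Ioo (-ρ) ρ := fun x hx => abs_lt.1 ((abs_lt.2 hx).trans_le
    ((min_le_right _ _).trans (min_le_left _ _)))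
  have hRδ : Ioo (-R) R ⊆ Ioo (-δ) δ := fun x hx => abs_lt.1 ((abs_lt.2 hx).trans_le
    ((min_le_right _ _).trans (min_le_right _ _)))
  have hkX : ∀ x ∈ Ioo (-R) R, k (X x) = h (X x) := fun x hx =>
    hkh (Ioo_subset_Icc_self (hRd x hx))
  have hder : ∀ x ∈ Ioo (-R) R, x ≠ 0 → HasDerivAt (fun x => e (X x)) 1 x := by
    intro x hx hx0
    obtain ⟨-, hpos, -, hne, hgx⟩ := hall x (hRρ hx)
    have hXx : X x ≠ 0 := fun h0 => by simpa [h0] using hpos hx0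
    have hP : HasDerivAt (potential g) (g x) x := by
      refine intervalIntegral.integral_hasDerivAt_right ?_
        (hg.stronglyMeasurableAtFilter isOpen_Ioo x (hRδ hx))
        (hg.continuousAt (isOpen_Ioo.mem_nhds (hRδ hx)))
      refine (hg.mono ((ordConnected_Ioo.uIcc_subset ?_ (hRδ hx)))).intervalIntegrable
      exact ⟨by linarith, hδ⟩
    have hsq : HasDerivAt (fun y => X y ^ 2) (2 * g x) x :=
      (hP.const_mul 2).congr_of_eventuallyEq (Filter.eventually_of_mem
        (isOpen_Ioo.mem_nhds (hRρ hx)) fun y hy => (hall y hy).1)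
    have hXd := hasDerivAt_of_sq (hX.continuousAt (isOpen_Ioo.mem_nhds (hRρ hx))) hXx hsq
    refine ((he (X x)).comp x hXd).congr_deriv ?_
    rw [hkX x hx, hgx]
    field_simp
  have hcont : ContinuousOn (fun x => e (X x)) (Ioo (-R) R) :=
    e.continuous.comp_continuousOn (hX.mono hRρ)
  -- At `0` the square root argument fails as `X` vanishes, so the mean value theorem is applied on
  -- each side separately.
  have hslope : ∀ a ∈ Ioo (-R) R, ∀ b ∈ Ioo (-R) R, a < b → (0 : ℝ) ∉ Ioo a b →
      e (X b) - e (X a) = b - a := by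
    intro a ha b hb hab h0
    have hsub : Icc a b ⊆ Ioo (-R) R := ordConnected_Ioo.out ha hb
    obtain ⟨y, -, hy⟩ := exists_hasDerivAt_eq_slope (fun x => e (X x)) (fun _ => 1) hab
      (hcont.mono hsub) fun y hy => hder y (hsub (Ioo_subset_Icc_self hy)) fun hy0 =>
        h0 (hy0 ▸ hy)
    have := sub_pos.2 hab
    field_simp at hy
    linarith
  have h0R : (0 : ℝ) ∈ Ioo (-R) R := ⟨by linarith, hR⟩
  filter_upwards [Ioo_mem_nhds h0R.1 h0R.2] with x hx
  have hex : e (X x) = x := by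
    rcases lt_trichotomy x 0 with hlt | rfl | hgt
    · have := hslope x hx 0 h0R hlt fun h => lt_irrefl _ h.2
      rw [hX0, he0] at this
      linarith
    · rw [hX0, he0]
    · have := hslope 0 h0R x hx hgt fun h => lt_irrefl _ h.1
      rw [hX0, he0] at this
      linarith
  have hXe : e.symm x = X x := by rw [OrderIso.symm_apply_eq, hex]
  rw [hXe, hkX x hx]
  exact (hall x (hRρ hx)).2.2.2.2

theorem contDiffAt_force {n : WithTop ℕ∞} {lam : ℝ} (hlam : 0 < lam) {k : ℝ → ℝ}
    (hb : ∀ s, |k s| ≤ 1 / 2) {c : ℝ} (hkn : ContDiffOn ℝ n k (Ioo (-c) c)) {e : ℝ ≃o ℝ}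
    (he : ∀ s, HasDerivAt e ((1 + k s) / lam) s) {x : ℝ} (hx : e.symm x ∈ Ioo (-c) c) :
    ContDiffAt ℝ n (fun x => lam * e.symm x / (1 + k (e.symm x))) x := by
  have hpos : ∀ s, 0 < 1 + k s := fun s => by linarith [(abs_le.1 (hb s)).1]
  have hen : ContDiffOn ℝ n e (Ioo (-c) c) :=
    contDiffOn_of_hasDerivAt isOpen_Ioo (fun s _ => he s)
      ((contDiffOn_const.add hkn).div_const lam)
  have hX : ContDiffAt ℝ n e.symm x :=
    e.toHomeomorph.toOpenPartialHomeomorph.contDiffAt_symm_deriv (a := x)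
      (div_pos (hpos _) hlam).ne' (mem_univ _) (he (e.symm x))
      ((hen _ hx).contDiffAt (isOpen_Ioo.mem_nhds hx))
  have hk : ContDiffAt ℝ n (fun x => k (e.symm x)) x :=
    ((hkn _ hx).contDiffAt (isOpen_Ioo.mem_nhds hx)).comp x hX
  exact (contDiffAt_const.mul hX).div (contDiffAt_const.add hk) (hpos _).ne'

/-! ### Existence and uniqueness -/

theorem exists_isIsochronousWithUrabe {lam : ℝ} (hlam : 0 < lam) {h : ℝ → ℝ} {ε : ℝ} (hε : 0 < ε)
    (hodd : ∀ s ∈ Ioo (-ε) ε, h (-s) = -h s) (hh : ContDiffOn ℝ 1 h (Ioo (-ε) ε)) :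
    ∃ (δ : ℝ) (g : ℝ → ℝ),
      (∀ n : WithTop ℕ∞, ContDiffOn ℝ n h (Ioo (-ε) ε) → ContDiffOn ℝ n g (Ioo (-δ) δ)) ∧
      IsIsochronousWithUrabe lam h δ g ∧
      ∀ (δ' : ℝ) (g' : ℝ → ℝ), ContinuousOn g' (Ioo (-δ') δ') →
        IsIsochronousWithUrabe lam h δ' g' → g' =ᶠ[𝓝 0] g := by
  obtain ⟨c, hc, hcε, k, hk, hb, hkodd, hkh⟩ := exists_truncation hε hodd hh.continuousOn
  obtain ⟨e, hee, he, hes, heb⟩ := exists_orderIso_of_abs_le_half hlam hk hb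
  have hpos : ∀ s, 0 < 1 + k s := fun s => by linarith [(abs_le.1 (hb s)).1]
  have hk0 : k 0 = 0 := by
    have := hkodd 0
    rw [neg_zero] at this
    linarith
  have he0 : e 0 = 0 := by simp [hee]
  have hs0 : e.symm 0 = 0 := by rw [OrderIso.symm_apply_eq, he0]
  have hsub : Ioo (-c) c ⊆ Ioo (-ε) ε := Ioo_subset_Ioo (by linarith) hcε.le
  have hkn : ∀ n : WithTop ℕ∞, ContDiffOn ℝ n h (Ioo (-ε) ε) → ContDiffOn ℝ n k (Ioo (-c) c) :=
    fun n hn => (hn.mono hsub).congr (hkh.mono Ioo_subset_Icc_self)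
  have h0c : (0 : ℝ) ∈ Ioo (-c) c := ⟨by linarith, hc⟩
  have hev : ∀ᶠ x in 𝓝 0, e.symm x ∈ Ioo (-c) c := e.symm.continuous.continuousAt.eventually
    (by rw [hs0]; exact Ioo_mem_nhds h0c.1 h0c.2)
  obtain ⟨d, hd, hball⟩ := Metric.eventually_nhds_iff.1 hev
  -- Halving `d` gives a compact interval, on which `C^1` implies Lipschitz.
  have hmem : ∀ x ∈ Icc (-(d / 2)) (d / 2), e.symm x ∈ Ioo (-c) c := fun x hx => hball (by
    rw [Real.dist_0_eq_abs]
    exact (abs_le.2 hx).trans_lt (half_lt_self hd))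
  let g : ℝ → ℝ := fun x => lam * e.symm x / (1 + k (e.symm x))
  have hgn : ∀ n : WithTop ℕ∞, ContDiffOn ℝ n h (Ioo (-ε) ε) →
      ContDiffOn ℝ n g (Icc (-(d / 2)) (d / 2)) := fun n hn x hx =>
    (contDiffAt_force hlam hb (hkn n hn) he (hmem x hx)).contDiffWithinAt
  obtain ⟨K, hK⟩ := (hgn 1 hh).exists_lipschitzOnWith one_ne_zero (convex_Icc _ _) isCompact_Icc
  have hgc : Continuous g := by
    have := e.symm.continuous
    exact (by fun_prop : Continuous fun x => lam * e.symm x).div (by fun_prop)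
      fun x => (hpos _).ne'
  have hpot : ∀ x, e.symm x ^ 2 = 2 * potential g x := fun x => by
    have hd : ∀ y ∈ uIcc 0 x, HasDerivAt (fun y => e.symm y ^ 2 / 2) (g y) y := fun y _ =>
      (((hes y).pow 2).div_const 2).congr_deriv (by simp only [g]; push_cast; ring)
    have := intervalIntegral.integral_eq_sub_of_hasDerivAt hd (hgc.intervalIntegrable _ _)
    rw [potential, this, hs0]
    ring
  refine ⟨d / 2, g, fun n hn => (hgn n hn).mono Ioo_subset_Icc_self,
    ⟨half_pos hd, by simp [g, hs0], ?_, ?_, ?_⟩, fun δ' g' hg' hU => ?_⟩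
  · have hkd : HasDerivAt k (deriv k 0) (e.symm 0) := by
      rw [hs0]
      exact ((((hkn 1 hh) 0 h0c).contDiffAt (isOpen_Ioo.mem_nhds h0c)).differentiableAt
        one_ne_zero).hasDerivAt
    have h1 := ((hes 0).const_mul lam).div ((hkd.comp 0 (hes 0)).const_add 1) (hpos _).ne'
    refine h1.congr_deriv ?_
    simp [hs0, hk0]
    ring
  · exact isIsochronousCenter_of_orderIso hlam hk hb hkodd he0 he heb (half_pos hd)
      (hK.mono Ioo_subset_Icc_self)
  · refine ⟨c, hc, hh.continuousOn.mono hsub, fun s hs => hodd s (hsub hs), d / 2, half_pos hd,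
      e.symm, e.symm.continuous.continuousOn, fun x hx => ?_⟩
    have hxc := hmem x (Ioo_subset_Icc_self hx)
    rw [← hkh (Ioo_subset_Icc_self hxc)]
    refine ⟨hpot x, fun hx0 => ?_, hxc, (hpos _).ne', rfl⟩
    rcases lt_or_gt_of_ne hx0 with hlt | hgt
    · exact mul_pos_of_neg_of_neg hlt (hs0 ▸ e.symm.strictMono hlt)
    · exact mul_pos hgt (hs0 ▸ e.symm.strictMono hgt)
  · exact hU.urabe.eventuallyEq hlam hU.pos hg' hc hkh he0 he

theorem mainTheorem5 (lam : ℝ) (hlam : 0 < lam) (h : ℝ → ℝ) (ε : ℝ) (hε : 0 < ε)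
    (hodd : ∀ s ∈ Ioo (-ε) ε, h (-s) = -h s) :
    (∀ k : ℕ∞, 1 ≤ k → ContDiffOn ℝ (k : WithTop ℕ∞) h (Ioo (-ε) ε) →
      ∃ (δ : ℝ) (g : ℝ → ℝ),
        ContDiffOn ℝ ((k - 1 : ℕ∞) : WithTop ℕ∞) g (Ioo (-δ) δ) ∧
        ContDiffOn ℝ 1 g (Ioo (-δ) δ) ∧
        IsIsochronousWithUrabe lam h δ g ∧
        ∀ (δ' : ℝ) (g' : ℝ → ℝ),
          ContDiffOn ℝ ((k - 1 : ℕ∞) : WithTop ℕ∞) g' (Ioo (-δ') δ') →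
          IsIsochronousWithUrabe lam h δ' g' → g' =ᶠ[𝓝 0] g) ∧
    (AnalyticOnNhd ℝ h (Ioo (-ε) ε) →
      ∃ (δ : ℝ) (g : ℝ → ℝ),
        AnalyticOnNhd ℝ g (Ioo (-δ) δ) ∧
        IsIsochronousWithUrabe lam h δ g ∧
        ∀ (δ' : ℝ) (g' : ℝ → ℝ),
          AnalyticOnNhd ℝ g' (Ioo (-δ') δ') →
          IsIsochronousWithUrabe lam h δ' g' → g' =ᶠ[𝓝 0] g) := by

  refine ⟨fun k hk hh => ?_, fun hh => ?_⟩
  · obtain ⟨δ, g, hreg, hg, huniq⟩ := exists_isIsochronousWithUrabe hlam hε hodd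
      (hh.of_le (by exact_mod_cast hk))
    -- The constructed `g` is even `C^k`, and uniqueness needs only continuity of `g'`.
    exact ⟨δ, g, (hreg k hh).of_le (by exact_mod_cast tsub_le_self),
      (hreg k hh).of_le (by exact_mod_cast hk), hg,
      fun δ' g' hg' => huniq δ' g' hg'.continuousOn⟩
  · obtain ⟨δ, g, hreg, hg, huniq⟩ := exists_isIsochronousWithUrabe hlam hε hodd
      hh.contDiffOn_of_completeSpace
    refine ⟨δ, g, fun x hx => ?_, hg, fun δ' g' hg' => huniq δ' g' hg'.continuousOn⟩
    -- Here `⊤` is the analytic exponent `ω`, not `∞`.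
    exact ((hreg ⊤ hh.contDiffOn_of_completeSpace x hx).contDiffAt
      (isOpen_Ioo.mem_nhds hx)).analyticAt
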